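/- Let \[ F(x,y,z) = 10x^3y^3 + 9x^5z + 9y^5z - 45x^2y^2z^2 - 135xyz^4 + 27z^6 \in \mathbb{C}[x,y,z] \] be the Wiman sextic, and let $\Phi$, homogeneous of degree $12$, be its Hessian, i.e. the determinant of the $3\times 3$ matrix of second partial derivatives of $F$. For $P \in \mathbb{P}^1(\mathbb{C}) = \mathbb{C} \cup \{\infty\}$, let $C_P \subset \mathbb{P}^2_{\mathbb{C}}$ be the plane curve defined by $P F^2 + \Phi = 0$ if $P \in \mathbb{C}$, and by $F^2 = 0$ if $P = \infty$. The quadratic equation $p^2 + 3375p + 7593750 = 0$ has two distinct, complex conjugate roots $\xi, \overline{\xi}$, and the curve $C_P$ is singular (that is, the form defining it and all its first partial derivatives vanish at some point of $\mathbb{P}^2(\mathbb{C})$) if and only if \[ P \in \{\infty,\ 20250,\ -10125,\ \xi,\ \overline{\xi}\}. \] The curve $C_P$ is reduced (that is, the quotient of $\mathbb{C}[x,y,z]$ by the form defining it is a reduced ring) if and only if $P \neq \infty$. -/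

import Mathlib

open MvPolynomial
open scoped OnePoint ComplexConjugate

/-- The Wiman sextic
`F = 10 x³y³ + 9 x⁵z + 9 y⁵z - 45 x²y²z² - 135 xyz⁴ + 27 z⁶`,
with `x, y, z` the variables `X 0, X 1, X 2`. -/
noncomputable def wimanSextic : MvPolynomial (Fin 3) ℂ :=
  10 * X 0 ^ 3 * X 1 ^ 3 + 9 * X 0 ^ 5 * X 2 + 9 * X 1 ^ 5 * X 2
    - 45 * X 0 ^ 2 * X 1 ^ 2 * X 2 ^ 2 - 135 * X 0 * X 1 * X 2 ^ 4 + 27 * X 2 ^ 6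

/-- The Hessian of a ternary form: the determinant of its matrix of second partial derivatives. -/
noncomputable def hessian (G : MvPolynomial (Fin 3) ℂ) : MvPolynomial (Fin 3) ℂ :=
  (Matrix.of fun i j : Fin 3 => pderiv i (pderiv j G)).det

/-- The member `a F² + b Φ` of the pencil spanned by `F²` and `Φ`, where `F` is the Wiman sextic
and `Φ` is its Hessian. -/
noncomputable def pencilForm (a b : ℂ) : MvPolynomial (Fin 3) ℂ :=
  C a * wimanSextic ^ 2 + C b * hessian wimanSextic

/-- The form of degree 12 that defines the curve `C_P`, for `P` in `ℙ¹(ℂ) = ℂ ∪ {∞}`.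
The parameter `P = a / b` corresponds to the point `(a : b)`: it is `P F² + Φ` for `P ∈ ℂ`,
and `F²` for `P = ∞`. -/
noncomputable def curveForm : OnePoint ℂ → MvPolynomial (Fin 3) ℂ
  | ∞ => pencilForm 1 0
  | OnePoint.some p => pencilForm p 1

/-- The projective plane curve `G = 0` (for `G` homogeneous) is singular: some point of `ℙ²(ℂ)`,
given by homogeneous coordinates `v ≠ 0`, lies on the curve and annihilates all the first partial
derivatives of `G`. -/
def IsSingularCurve (G : MvPolynomial (Fin 3) ℂ) : Prop :=
  ∃ v : Fin 3 → ℂ, v ≠ 0 ∧ eval v G = 0 ∧ ∀ i : Fin 3, eval v (pderiv i G) = 0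

/-- The projective plane curve `G = 0` (for `G` homogeneous) is reduced: its homogeneous
coordinate ring `ℂ[x, y, z] / (G)` is reduced. -/
def IsReducedCurve (G : MvPolynomial (Fin 3) ℂ) : Prop :=
  IsReduced (MvPolynomial (Fin 3) ℂ ⧸ Ideal.span {G})

/-! Both `F` and `Φ` are invariant under the dihedral group generated by (x, y) ↦ (ζx, ζ⁻¹y), ζ⁵ =
1, and x ↔ y, hence are polynomials in u, s and z. The map (x, y) ↦ (u, s) has Jacobian 5(y⁵ - x⁵).
Off the mirrors x⁵ = y⁵ a singular point is therefore a critical point in (u, s)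
(`isExceptional_of_invForm`); on a mirror a rotation brings it to x = y, leaving one variable
(`isExceptional_of_axis`). Both systems are solved by elimination: a resultant-like polynomial
factors, and each factor determines p or its quadratic equation. The line z = 0 is treated
separately, and explicit points give the converse.

For reducedness, a form that is not squarefree is divisible by H² with H a form of positive degree,
and H vanishes somewhere on every line, so the curve is singular somewhere on every line. On z = 0
this forces p = -10125, and that member is smooth along x = 0. -/

/-- The Wiman sextic in terms of `u = xy`, `s = x⁵ + y⁵` and `z`. -/
def invSextic {R : Type*} [CommRing R] (u s z : R) : R :=
  10 * u ^ 3 - 45 * u ^ 2 * z ^ 2 - 135 * u * z ^ 4 + 9 * s * z + 27 * z ^ 6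

/-- The form `p F² + Φ` in terms of `u = xy`, `s = x⁵ + y⁵` and `z`. -/
def invForm {R : Type*} [CommRing R] (p u s z : R) : R :=
  p * invSextic u s z ^ 2 + (1012500 * u ^ 6 + 9112500 * u ^ 5 * z ^ 2 - 68343750 * u ^ 4 * z ^ 4
    - 1822500 * u ^ 3 * s * z + 21870000 * u ^ 3 * z ^ 6 - 21870000 * u ^ 2 * s * z ^ 3
    - 24603750 * u ^ 2 * z ^ 8 - 121500 * u * s ^ 2 + 6561000 * u * s * z ^ 5
    - 88573500 * u * z ^ 10 + 182250 * s ^ 2 * z ^ 2 - 59049000 * s * z ^ 7 - 14762250 * z ^ 12)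

/-- The partial derivative of `invForm` with respect to `u`. -/
def invFormU {R : Type*} [CommRing R] (p u s z : R) : R :=
  2 * p * invSextic u s z * (30 * u ^ 2 - 90 * u * z ^ 2 - 135 * z ^ 4)
    + (6075000 * u ^ 5 + 45562500 * u ^ 4 * z ^ 2 - 273375000 * u ^ 3 * z ^ 4
    - 5467500 * u ^ 2 * s * z + 65610000 * u ^ 2 * z ^ 6 - 43740000 * u * s * z ^ 3
    - 49207500 * u * z ^ 8 - 121500 * s ^ 2 + 6561000 * s * z ^ 5 - 88573500 * z ^ 10)

/-- The partial derivative of `invForm` with respect to `s`. -/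
def invFormS {R : Type*} [CommRing R] (p u s z : R) : R :=
  2 * p * invSextic u s z * (9 * z) + (- 1822500 * u ^ 3 * z - 21870000 * u ^ 2 * z ^ 3
    - 243000 * u * s + 6561000 * u * z ^ 5 + 364500 * s * z ^ 2 - 59049000 * z ^ 7)

/-- The partial derivative of `invForm` with respect to `z`. -/
def invFormZ {R : Type*} [CommRing R] (p u s z : R) : R :=
  2 * p * invSextic u s z * (- 90 * u ^ 2 * z - 540 * u * z ^ 3 + 9 * s + 162 * z ^ 5)
    + (18225000 * u ^ 5 * z - 273375000 * u ^ 4 * z ^ 3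
    - 1822500 * u ^ 3 * s + 131220000 * u ^ 3 * z ^ 5 - 65610000 * u ^ 2 * s * z ^ 2
    - 196830000 * u ^ 2 * z ^ 7 + 32805000 * u * s * z ^ 4
    - 885735000 * u * z ^ 9 + 364500 * s ^ 2 * z - 413343000 * s * z ^ 6 - 177147000 * z ^ 11)

/-! ### Gradient of the pencil in invariant coordinates -/

section
variable {A : Type*} [CommRing A] [Algebra ℂ A] (D : Derivation ℂ A A)

theorem derivation_ofNat (n : ℕ) [n.AtLeastTwo] : D ofNat(n) = 0 :=
  D.map_natCast n

theorem derivation_invForm (p : ℂ) (u s z : A) :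
    D (invForm (algebraMap ℂ A p) u s z) = invFormU (algebraMap ℂ A p) u s z * D u
      + invFormS (algebraMap ℂ A p) u s z * D s + invFormZ (algebraMap ℂ A p) u s z * D z := by
  simp only [invForm, invFormU, invFormS, invFormZ, invSextic, map_add, map_sub, D.leibniz,
    D.leibniz_pow, D.map_algebraMap, derivation_ofNat D, smul_eq_mul, nsmul_eq_mul]
  push_cast
  ring

end

theorem pderiv_ofNat (i : Fin 3) (n : ℕ) [n.AtLeastTwo] :
    pderiv i (ofNat(n) : MvPolynomial (Fin 3) ℂ) = 0 :=
  (pderiv i).map_natCast n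

theorem wimanSextic_eq_invSextic :
    wimanSextic = invSextic (X 0 * X 1) (X 0 ^ 5 + X 1 ^ 5) (X 2) := by
  rw [wimanSextic, invSextic]; ring

theorem pderiv_zero_wimanSextic : pderiv 0 wimanSextic = 30 * X 0 ^ 2 * X 1 ^ 3
    + 45 * X 0 ^ 4 * X 2 - 90 * X 0 * X 1 ^ 2 * X 2 ^ 2 - 135 * X 1 * X 2 ^ 4 := by
  simp only [wimanSextic, map_add, map_sub, Derivation.leibniz, Derivation.leibniz_pow,
    pderiv_X, pderiv_ofNat, smul_eq_mul, nsmul_eq_mul, Pi.single_apply]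
  simp
  ring

theorem pderiv_one_wimanSextic : pderiv 1 wimanSextic = 30 * X 0 ^ 3 * X 1 ^ 2
    + 45 * X 1 ^ 4 * X 2 - 90 * X 0 ^ 2 * X 1 * X 2 ^ 2 - 135 * X 0 * X 2 ^ 4 := by
  simp only [wimanSextic, map_add, map_sub, Derivation.leibniz, Derivation.leibniz_pow,
    pderiv_X, pderiv_ofNat, smul_eq_mul, nsmul_eq_mul, Pi.single_apply]
  simp
  ring

theorem pderiv_two_wimanSextic : pderiv 2 wimanSextic = 9 * X 0 ^ 5 + 9 * X 1 ^ 5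
    - 90 * X 0 ^ 2 * X 1 ^ 2 * X 2 - 540 * X 0 * X 1 * X 2 ^ 3 + 162 * X 2 ^ 5 := by
  simp only [wimanSextic, map_add, map_sub, Derivation.leibniz, Derivation.leibniz_pow,
    pderiv_X, pderiv_ofNat, smul_eq_mul, nsmul_eq_mul, Pi.single_apply]
  simp
  ring

/-- The long bracket in `invForm` is this Hessian, as the case p = 0 shows. -/
theorem hessian_wimanSextic : hessian wimanSextic =
    invForm 0 (X 0 * X 1) (X 0 ^ 5 + X 1 ^ 5) (X 2) := by
  rw [hessian, Matrix.det_fin_three]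
  simp only [Matrix.of_apply, pderiv_zero_wimanSextic, pderiv_one_wimanSextic,
    pderiv_two_wimanSextic, map_add, map_sub, Derivation.leibniz, Derivation.leibniz_pow,
    pderiv_X, pderiv_ofNat, smul_eq_mul, nsmul_eq_mul, Pi.single_apply]
  simp only [Fin.isValue, Fin.reduceEq, if_true, if_false, invForm, zero_mul, zero_add, mul_zero,
    add_zero, sub_zero, mul_one, Nat.add_one_sub_one]
  push_cast
  ring

theorem pencilForm_one_right (p : ℂ) :
    pencilForm p 1 = invForm (C p) (X 0 * X 1) (X 0 ^ 5 + X 1 ^ 5) (X 2) := by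
  rw [pencilForm, hessian_wimanSextic, wimanSextic_eq_invSextic, invForm, invForm]
  simp

theorem eval_pencilForm (p : ℂ) (v : Fin 3 → ℂ) :
    eval v (pencilForm p 1) = invForm p (v 0 * v 1) (v 0 ^ 5 + v 1 ^ 5) (v 2) := by
  simp [pencilForm_one_right, invForm, invSextic]

theorem eval_pderiv_pencilForm (p : ℂ) (v : Fin 3 → ℂ) (i : Fin 3) :
    eval v (pderiv i (pencilForm p 1)) =
      invFormU p (v 0 * v 1) (v 0 ^ 5 + v 1 ^ 5) (v 2) * eval v (pderiv i (X 0 * X 1))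
      + invFormS p (v 0 * v 1) (v 0 ^ 5 + v 1 ^ 5) (v 2) * eval v (pderiv i (X 0 ^ 5 + X 1 ^ 5))
      + invFormZ p (v 0 * v 1) (v 0 ^ 5 + v 1 ^ 5) (v 2) * eval v (pderiv i (X 2)) := by
  rw [pencilForm_one_right, ← algebraMap_eq, derivation_invForm]
  simp [invFormU, invFormS, invFormZ, invSextic]

/-- The equations of the singular locus of `p F² + Φ` at the point `(x : y : z)`. -/
structure IsSingularAt (p x y z : ℂ) : Prop where
  value : invForm p (x * y) (x ^ 5 + y ^ 5) z = 0
  dx : invFormU p (x * y) (x ^ 5 + y ^ 5) z * y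
    + invFormS p (x * y) (x ^ 5 + y ^ 5) z * (5 * x ^ 4) = 0
  dy : invFormU p (x * y) (x ^ 5 + y ^ 5) z * x
    + invFormS p (x * y) (x ^ 5 + y ^ 5) z * (5 * y ^ 4) = 0
  dz : invFormZ p (x * y) (x ^ 5 + y ^ 5) z = 0

theorem isSingularAt_iff (p : ℂ) (v : Fin 3 → ℂ) : IsSingularAt p (v 0) (v 1) (v 2) ↔
    eval v (pencilForm p 1) = 0 ∧ ∀ i : Fin 3, eval v (pderiv i (pencilForm p 1)) = 0 := by
  rw [Fin.forall_fin_succ, Fin.forall_fin_two]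
  simp only [eval_pderiv_pencilForm, eval_pencilForm]
  simp [Derivation.leibniz, Derivation.leibniz_pow, pderiv_X]
  exact ⟨fun h => ⟨h.1, h.2, h.3, h.4⟩, fun h => ⟨h.1, h.2.1, h.2.2.1, h.2.2.2⟩⟩

theorem isSingularCurve_pencilForm_iff (p : ℂ) : IsSingularCurve (pencilForm p 1) ↔
    ∃ x y z, ¬(x = 0 ∧ y = 0 ∧ z = 0) ∧ IsSingularAt p x y z := by
  constructor
  · rintro ⟨v, hv, h⟩
    refine ⟨v 0, v 1, v 2, fun h0 => hv ?_, (isSingularAt_iff p v).2 h⟩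
    ext i
    fin_cases i
    exacts [h0.1, h0.2.1, h0.2.2]
  · rintro ⟨x, y, z, h0, h⟩
    exact ⟨![x, y, z], fun hv => h0 ⟨congrFun hv 0, congrFun hv 1, congrFun hv 2⟩,
      (isSingularAt_iff p ![x, y, z]).1 h⟩

/-! ### Singular finite members are exceptional -/

/-- The finite parameters of the singular members of the pencil. -/
def IsExceptional (p : ℂ) : Prop :=
  p = 20250 ∨ p = -10125 ∨ p ^ 2 + 3375 * p + 7593750 = 0

theorem IsSingularAt.of_scaled {p x y z : ℂ} (hz : z ≠ 0)
    (h : IsSingularAt p (x * z) (y * z) z) : IsSingularAt p x y 1 := by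
  obtain ⟨h0, h1, h2, h3⟩ := h
  have h12 : z ^ 12 ≠ 0 := pow_ne_zero _ hz
  have h11 : z ^ 11 ≠ 0 := pow_ne_zero _ hz
  constructor
  · refine (mul_eq_zero.1 (?_ : z ^ 12 * _ = 0)).resolve_left h12
    rw [← h0]; simp only [invForm, invSextic]; ring
  · refine (mul_eq_zero.1 (?_ : z ^ 11 * _ = 0)).resolve_left h11
    rw [← h1]; simp only [invFormU, invFormS, invSextic]; ring
  · refine (mul_eq_zero.1 (?_ : z ^ 11 * _ = 0)).resolve_left h11
    rw [← h2]; simp only [invFormU, invFormS, invSextic]; ring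
  · refine (mul_eq_zero.1 (?_ : z ^ 11 * _ = 0)).resolve_left h11
    rw [← h3]; simp only [invFormZ, invSextic]; ring

/-- On the line `z = 0`, only the member with parameter `-10125` has singular points. -/
theorem IsSingularAt.eq_of_z_eq_zero {p x y : ℂ} (hxy : ¬(x = 0 ∧ y = 0))
    (h : IsSingularAt p x y 0) : p = -10125 := by
  obtain ⟨h0, h1, h2, h3⟩ := h
  simp only [invForm, invFormU, invFormS, invFormZ, invSextic] at h0 h1 h2 h3
  have key : x = 0 ∨ y = 0 ∨ p = -10125 := by
    by_contra! hne
    obtain ⟨hx, hy, hp⟩ := hne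
    have hu : x * y ≠ 0 := mul_ne_zero hx hy
    by_cases hs : x ^ 5 + y ^ 5 = 0
    · rw [hs] at h0
      have : (x * y) ^ 6 * (100 * (p + 10125)) = 0 := by linear_combination h0
      rcases mul_eq_zero.1 this with h | h
      · exact pow_ne_zero _ hu h
      · exact hp (by linear_combination h / 100)
    -- At z = 0 the z-derivative is 180u³s(p - 10125).
    · have hp' : p - 10125 = 0 := by
        refine (mul_eq_zero.1 (?_ : (180 * (x * y) ^ 3 * (x ^ 5 + y ^ 5)) * _ = 0)).resolve_left
          (mul_ne_zero (mul_ne_zero (by norm_num) (pow_ne_zero _ hu)) hs)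
        linear_combination h3
      have hp' : p = 10125 := by linear_combination hp'
      subst hp'
      have hd : x ^ 5 - y ^ 5 = 0 := by
        refine (mul_eq_zero.1 (?_ : (-1215000 * (x * y) * (x ^ 5 + y ^ 5)) * _ = 0)).resolve_left
          (mul_ne_zero (mul_ne_zero (by norm_num) hu) hs)
        linear_combination x * h1 - y * h2
      have hd : y ^ 5 = x ^ 5 := by linear_combination -hd
      -- Here s = 2x⁵ and u⁵ = (x⁵)², so the value is a nonzero multiple of u·x¹⁰.
      have : (2025000 - 486000) * (x * y) * (x ^ 5) ^ 2 = 0 := by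
        linear_combination h0 - (x * y) * (2025000 * x ^ 5 - 121500 * (3 * x ^ 5 + y ^ 5)) * hd
      exact mul_ne_zero (mul_ne_zero (by norm_num) hu) (pow_ne_zero _ (pow_ne_zero _ hx)) this
  rcases key with rfl | rfl | h
  · exfalso
    have : y ^ 11 = 0 := by linear_combination -h1 / 121500
    exact hxy ⟨rfl, pow_eq_zero_iff (by norm_num) |>.1 this⟩
  · exfalso
    have : x ^ 11 = 0 := by linear_combination -h2 / 121500
    exact hxy ⟨pow_eq_zero_iff (by norm_num) |>.1 this, rfl⟩
  · exact h

/-- The member with parameter `-10125` has no singular points on the line `x = 0`. -/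
theorem not_isSingularAt_of_x_eq_zero {y z : ℂ} (hyz : ¬(y = 0 ∧ z = 0)) :
    ¬ IsSingularAt (-10125) 0 y z := by
  intro h
  by_cases hz : z = 0
  · subst hz
    have h1 := h.dx
    simp only [invFormU, invFormS, invSextic] at h1
    have : y ^ 11 = 0 := by linear_combination -h1 / 121500
    exact hyz ⟨pow_eq_zero_iff (by norm_num) |>.1 this, rfl⟩
  · obtain ⟨b, rfl⟩ : ∃ b, y = b * z := ⟨y / z, by field_simp⟩
    have h := IsSingularAt.of_scaled (x := 0) hz (by simpa using h)
    obtain ⟨h0, -, h2, -⟩ := h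
    simp only [invForm, invFormU, invFormS, invSextic] at h0 h2
    by_cases hb : b = 0
    · subst hb
      norm_num at h0
    · have h2 : (63969750 + 1275750 * b ^ 5) = 0 := by
        refine (mul_eq_zero.1 (?_ : (- 5 * b ^ 4) * _ = 0)).resolve_left
          (mul_ne_zero (by norm_num) (pow_ne_zero _ hb))
        linear_combination h2
      -- The value is quadratic in b⁵ and `h2` is linear in b⁵; they have no common root.
      have : (22143375000 : ℂ) = 0 := by
        linear_combination 14 * h0 + (7 * b ^ 5 + 351) * h2
      norm_num at this

/-- Singular points off the axes of the visible reflections, in the coordinates `u`, `s`. -/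
theorem isExceptional_of_invForm {p u s : ℂ} (h0 : invForm p u s 1 = 0)
    (hu : invFormU p u s 1 = 0) (hs : invFormS p u s 1 = 0) : IsExceptional p := by
  -- At z = 1 the sextic is linear in s, so f replaces s as a coordinate. The form becomes (p + c)f²
  -- + bf + a with a, b, c in ℂ[u]; primes are u-derivatives.
  obtain ⟨f, hf⟩ : ∃ f, f = invSextic u s 1 := ⟨_, rfl⟩
  obtain ⟨c, hc⟩ : ∃ c, c = 2250 - 1500 * u := ⟨_, rfl⟩
  obtain ⟨b, hb⟩ : ∃ b, b = 30000 * u ^ 4 - 382500 * u ^ 3 - 2632500 * u ^ 2 + 1417500 * u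
    - 6682500 := ⟨_, rfl⟩
  obtain ⟨b', hb'⟩ : ∃ b', b' = 120000 * u ^ 3 - 1147500 * u ^ 2 - 5265000 * u + 1417500 :=
    ⟨_, rfl⟩
  obtain ⟨a, ha⟩ : ∃ a, a = -150000 * u ^ 7 + 4612500 * u ^ 6 + 23287500 * u ^ 5
    - 232875000 * u ^ 4 - 197437500 * u ^ 3 - 109350000 * u ^ 2 - 1011487500 * u + 164025000 :=
    ⟨_, rfl⟩
  obtain ⟨a', ha'⟩ : ∃ a', a' = -1050000 * u ^ 6 + 27675000 * u ^ 5 + 116437500 * u ^ 4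
    - 931500000 * u ^ 3 - 592312500 * u ^ 2 - 218700000 * u - 1011487500 := ⟨_, rfl⟩
  have e0 : (p + c) * f ^ 2 + b * f + a = 0 := by
    rw [← h0, hf, hc, hb, ha]; simp only [invForm, invSextic]; ring
  have e1 : 2 * (p + c) * f + b = 0 := by
    have : 9 * (2 * (p + c) * f + b) = 0 := by
      rw [← hs, hf, hc, hb]; simp only [invFormS, invSextic]; ring
    linear_combination this / 9
  have e2 : -1500 * f ^ 2 + b' * f + a' = 0 := by
    have : -1500 * f ^ 2 + b' * f + a'
        + (30 * u ^ 2 - 90 * u - 135) * (2 * (p + c) * f + b) = 0 := by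
      rw [← hu, hf, hc, hb, hb', ha']; simp only [invFormU, invSextic]; ring
    linear_combination this - (30 * u ^ 2 - 90 * u - 135) * e1
  have e3 : b * f = -2 * a := by linear_combination 2 * e0 - f * e1
  rcases eq_or_ne f 0 with rfl | hf0
  · exfalso
    have h1 : a = 0 := by linear_combination e0
    have h2 : a' = 0 := by linear_combination e2
    rw [ha] at h1
    rw [ha'] at h2
    -- Bézout identity for a and a': a has no multiple root. The nonzero constants below arise
    -- likewise from coprime polynomials.
    have : (75668064257812500 : ℂ) = 0 := by
      linear_combination (91504 * u ^ 5 - 2389272 * u ^ 4 - 10737972 * u ^ 3 + 78518268 * u ^ 2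
        + 73913148 * u + 42802749) * h1 + (-13072 * u ^ 6 + 398748 * u ^ 5 + 2127960 * u ^ 4
        - 19770210 * u ^ 3 - 22575105 * u ^ 2 - 16142733 * u - 67867713) * h2
    norm_num at this
  -- Using bf = -2a to eliminate f leaves p as a function of u and one equation in u alone, which
  -- factors.
  have e4 : 4 * (p + c) * a = b ^ 2 := by linear_combination 2 * (p + c) * e3 - b * e1
  have e5 : -6000 * a ^ 2 - 2 * a * b * b' + a' * b ^ 2 = 0 := by
    linear_combination b ^ 2 * e2 + (1500 * (b * f - 2 * a) - b' * b) * e3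
  have e6 : (4 * u ^ 2 - 3 * u + 9) ^ 2 * ((u ^ 2 - 12 * u - 9) * ((u ^ 2 + 3 * u - 9) *
      (u ^ 4 + 21 * u ^ 3 + 216 * u ^ 2 + 351 * u + 2511))) = 0 := by
    rw [ha, hb, hb', ha'] at e5
    linear_combination -e5 / 2562890625000000
  rcases mul_eq_zero.1 e6 with h | h
  · have h := pow_eq_zero_iff (by norm_num) |>.1 h
    -- 4u² - 3u + 9 divides b, so p = -c and the quadratic for p is this one rescaled.
    have hb0 : b = 0 := by
      rw [hb]; linear_combination (7500 * u ^ 2 - 90000 * u - 742500) * h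
    have hp : p + c = 0 := by
      refine (mul_eq_zero.1 (?_ : f * (p + c) = 0)).resolve_left hf0
      linear_combination e1 / 2 - hb0 / 2
    have hp : p = 1500 * u - 2250 := by linear_combination hp - hc
    refine Or.inr (Or.inr ?_)
    rw [hp]
    linear_combination 562500 * h
  rw [hc] at e4
  rcases mul_eq_zero.1 h with h | h
  · have ha0 : a ≠ 0 := by
      intro h0
      rw [ha] at h0
      have : (615093750000 : ℂ) = 0 := by
        linear_combination (-55 * u + 699) * h0 + (-8250000 * u ^ 6 + 259537500 * u ^ 5
          + 1096875000 * u ^ 4 - 13587750000 * u ^ 3 - 1260562500 * u ^ 2 - 5421937500 * u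
          - 55604475000) * h
      norm_num at this
    refine Or.inl (sub_eq_zero.1 ((mul_eq_zero.1 (?_ : a * _ = 0)).resolve_left ha0))
    rw [hb, ha] at e4
    rw [ha]
    linear_combination e4 / 4 + (18225000000 * u ^ 5 - 68343750000 * u ^ 4 - 2050312500000 * u ^ 3
      - 3690562500000 * u - 3321506250000) * h / 4
  rcases mul_eq_zero.1 h with h | h
  · have ha0 : a ≠ 0 := by
      intro h0
      rw [ha] at h0
      have : (153773437500 : ℂ) = 0 := by
        linear_combination (-4 * u - 21) * h0 + (-600000 * u ^ 6 + 17100000 * u ^ 5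
          + 133312500 * u ^ 4 - 688500000 * u ^ 3 - 2414812500 * u ^ 2 - 3535650000 * u
          - 17468662500) * h
      norm_num at this
    refine Or.inr (Or.inl (sub_eq_zero.1 ((mul_eq_zero.1 (?_ : a * _ = 0)).resolve_left ha0)))
    rw [hb, ha] at e4
    rw [ha]
    linear_combination e4 / 4 + (273375000000 * u ^ 4 + 615093750000 * u ^ 3
      - 2460375000000 * u ^ 2 + 3690562500000 * u - 5535843750000) * h / 4
  · have ha0 : a ≠ 0 := by
      intro h0
      rw [ha] at h0
      have : (6726050156250000 : ℂ) = 0 := by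
        linear_combination (47 * u ^ 3 + 324 * u ^ 2 - 4104 * u - 124767) * h0
          + (7050000 * u ^ 6 - 316237500 * u ^ 5 + 1913625000 * u ^ 4 + 29261250000 * u ^ 3
          - 178741687500 * u ^ 2 - 425562862500 * u + 2686784175000) * h
      norm_num at this
    refine Or.inr (Or.inr ((mul_eq_zero.1 (?_ : a ^ 2 * _ = 0)).resolve_left (pow_ne_zero _ ha0)))
    -- n = 4pa, so `e8` is the quadratic for p multiplied by 16a².
    obtain ⟨n, hn⟩ : ∃ n, n = b ^ 2 - 4 * a * (2250 - 1500 * u) := ⟨_, rfl⟩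
    have e7 : 4 * p * a = n := by linear_combination e4 - hn
    have e8 : n ^ 2 + 13500 * n * a + 121500000 * a ^ 2 = 0 := by
      rw [hn, hb, ha]
      linear_combination (27337500000000000000 * u ^ 10 + 512578125000000000000 * u ^ 9
        + 4843863281250000000000 * u ^ 8 + 864975585937500000000 * u ^ 7
        + 91341421875000000000000 * u ^ 6 - 125179266796875000000000 * u ^ 5
        + 583858520507812500000000 * u ^ 4 - 602541993164062500000000 * u ^ 3
        + 1261134404296875000000000 * u ^ 2 - 672605015625000000000000 * u
        + 781903330664062500000000) * h
    linear_combination e8 / 16 + (4 * p * a + n + 13500 * a) * e7 / 16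

/-- Singular points on the axis `x = y` of a reflection. -/
theorem isExceptional_of_axis {p w : ℂ} (h0 : invForm p (w ^ 2) (2 * w ^ 5) 1 = 0)
    (h1 : invFormU p (w ^ 2) (2 * w ^ 5) 1 * w + invFormS p (w ^ 2) (2 * w ^ 5) 1 * (5 * w ^ 4)
      = 0) : IsExceptional p := by
  -- f and g are the restrictions of `F` and `Φ` to the point (w : w : 1).
  obtain ⟨f, hf⟩ : ∃ f, f = 10 * w ^ 6 + 18 * w ^ 5 - 45 * w ^ 4 - 135 * w ^ 2 + 27 := ⟨_, rfl⟩
  obtain ⟨f', hf'⟩ : ∃ f', f' = 60 * w ^ 5 + 90 * w ^ 4 - 180 * w ^ 3 - 270 * w := ⟨_, rfl⟩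
  obtain ⟨g, hg⟩ : ∃ g, g = 526500 * w ^ 12 - 3645000 * w ^ 11 + 9841500 * w ^ 10
    - 43740000 * w ^ 9 - 68343750 * w ^ 8 + 13122000 * w ^ 7 + 21870000 * w ^ 6
    - 118098000 * w ^ 5 - 24603750 * w ^ 4 - 88573500 * w ^ 2 - 14762250 := ⟨_, rfl⟩
  obtain ⟨g', hg'⟩ : ∃ g', g' = 6318000 * w ^ 11 - 40095000 * w ^ 10 + 98415000 * w ^ 9
    - 393660000 * w ^ 8 - 546750000 * w ^ 7 + 91854000 * w ^ 6 + 131220000 * w ^ 5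
    - 590490000 * w ^ 4 - 98415000 * w ^ 3 - 177147000 * w := ⟨_, rfl⟩
  have e0 : p * f ^ 2 + g = 0 := by
    rw [← h0, hf, hg]; simp only [invForm, invSextic]; ring
  have e1 : 2 * p * f * f' + g' = 0 := by
    have : 2 * p * f * f' + g' = 2 * (invFormU p (w ^ 2) (2 * w ^ 5) 1 * w
        + invFormS p (w ^ 2) (2 * w ^ 5) 1 * (5 * w ^ 4)) := by
      rw [hf, hf', hg']; simp only [invFormU, invFormS, invSextic]; ring
    rw [this, h1, mul_zero]
  have hf0 : f ≠ 0 := by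
    intro h
    have h2 : g = 0 := by linear_combination e0 - p * f * h
    rw [hf] at h
    rw [hg] at h2
    have : (934173632812500 : ℂ) = 0 := by
      linear_combination (9468576000 * w ^ 11 - 166842909000 * w ^ 10 + 880981677000 * w ^ 9
        - 2718099220500 * w ^ 8 + 7367265252000 * w ^ 7 + 12812242432500 * w ^ 6
        - 921093322500 * w ^ 5 - 3681190658250 * w ^ 4 + 22499985033000 * w ^ 3
        + 3079318416750 * w ^ 2 + 1835695629000 * w + 19569069875250) * h
        + (-179840 * w ^ 5 + 1600148 * w ^ 4 + 4220088 * w ^ 3 - 8388312 * w ^ 2 + 3357468 * w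
        - 27489627) * h2
    norm_num at this
  -- Eliminating p: this is the numerator of the derivative of -g/f² = p, up to sign.
  have e2 : 2 * g * f' - g' * f = 0 := by linear_combination 2 * f' * e0 - f * e1
  have e3 : w * ((w ^ 3 + 2 * w ^ 2 + 3 * w - 6) * ((4 * w ^ 4 - 6 * w ^ 3 + 9 * w ^ 2 + 9 * w + 9)
      * (19 * w ^ 8 - 132 * w ^ 7 + 642 * w ^ 6 + 756 * w ^ 5 - 270 * w ^ 4 + 486 * w ^ 3
        + 837 * w ^ 2 - 162 * w + 324))) = 0 := by
    rw [hf, hf', hg, hg'] at e2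
    linear_combination -e2 / 729000
  have hff : f ^ 2 ≠ 0 := pow_ne_zero _ hf0
  rcases mul_eq_zero.1 e3 with h | h
  · refine Or.inl (sub_eq_zero.1 ((mul_eq_zero.1 (?_ : f ^ 2 * _ = 0)).resolve_left hff))
    have : f ^ 2 * (p - 20250) = -g - 20250 * f ^ 2 := by linear_combination e0
    rw [this, hf, hg]
    subst h
    norm_num
  rcases mul_eq_zero.1 h with h | h
  · refine Or.inl (sub_eq_zero.1 ((mul_eq_zero.1 (?_ : f ^ 2 * _ = 0)).resolve_left hff))
    have : f ^ 2 * (p - 20250) = -g - 20250 * f ^ 2 := by linear_combination e0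
    rw [this, hf, hg]
    linear_combination (-2551500 * w ^ 9 + 1458000 * w ^ 8 + 6561000 * w ^ 7 + 43740000 * w ^ 6
      - 16402500 * w ^ 5 + 26244000 * w ^ 4 - 19683000 * w ^ 3 - 39366000 * w ^ 2) * h
  rcases mul_eq_zero.1 h with h | h
  · refine Or.inr (Or.inl (sub_eq_zero.1 ((mul_eq_zero.1 (?_ : f ^ 2 * _ = 0)).resolve_left hff)))
    have : f ^ 2 * (p - -10125) = -g + 10125 * f ^ 2 := by linear_combination e0
    rw [this, hf, hg]
    linear_combination (121500 * w ^ 8 + 2004750 * w ^ 7 - 1184625 * w ^ 6 + 273375 * w ^ 5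
      + 13668750 * w ^ 4 + 2460375 * w ^ 3 + 1640250 * w ^ 2 - 2460375 * w + 2460375) * h
  · refine Or.inr (Or.inr ((mul_eq_zero.1 (?_ : (f ^ 2) ^ 2 * _ = 0)).resolve_left
      (pow_ne_zero _ hff)))
    have : (f ^ 2) ^ 2 * (p ^ 2 + 3375 * p + 7593750)
        = g ^ 2 - 3375 * g * f ^ 2 + 7593750 * (f ^ 2) ^ 2 := by
      linear_combination (p * f ^ 2 - g + 3375 * f ^ 2) * e0
    rw [this, hf, hg]
    linear_combination (9234000000 * w ^ 16 - 78003000000 * w ^ 15 + 508659750000 * w ^ 14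
      - 767090250000 * w ^ 13 + 2455317562500 * w ^ 12 + 5705609625000 * w ^ 11
      - 900087187500 * w ^ 10 - 3215710125000 * w ^ 9 + 11546539875000 * w ^ 8
      + 10193333625000 * w ^ 7 - 1236338437500 * w ^ 6 + 5779420875000 * w ^ 5
      + 10219167562500 * w ^ 4 + 531441000000 * w ^ 3 + 5513700375000 * w ^ 2
      + 398580750000 * w + 797161500000) * h

theorem IsSingularAt.isExceptional {p x y z : ℂ} (hv : ¬(x = 0 ∧ y = 0 ∧ z = 0))
    (h : IsSingularAt p x y z) : IsExceptional p := by
  by_cases hz : z = 0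
  · subst hz
    exact Or.inr (Or.inl (h.eq_of_z_eq_zero fun hxy => hv ⟨hxy.1, hxy.2, rfl⟩))
  obtain ⟨x, rfl⟩ : ∃ b, x = b * z := ⟨x / z, by field_simp⟩
  obtain ⟨y, rfl⟩ : ∃ b, y = b * z := ⟨y / z, by field_simp⟩
  have h := h.of_scaled hz
  by_cases hxy : x ^ 5 = y ^ 5
  · by_cases hx : x = 0
    · subst hx
      have hy : y = 0 := by simpa using hxy.symm
      subst hy
      refine isExceptional_of_axis (w := 0) ?_ (by simp)
      simpa using h.value
    -- With ζ = (y/x)³ a fifth root of unity, ζx = ζ⁻¹y = y³/x²; the rotated point lies on x = y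
    -- with the same u and s.
    · have hu : x * y = (y ^ 3 / x ^ 2) ^ 2 := by
        field_simp; linear_combination y * hxy
      have hs : (y ^ 3 / x ^ 2) ^ 5 = x ^ 5 := by
        field_simp; linear_combination -(x ^ 10 + x ^ 5 * y ^ 5 + y ^ 10) * hxy
      have hs' : x ^ 5 + y ^ 5 = 2 * (y ^ 3 / x ^ 2) ^ 5 := by
        rw [hs]; linear_combination -hxy
      obtain ⟨h0, h1, h2, h3⟩ := h
      rw [hu, hs'] at h0 h1
      refine isExceptional_of_axis h0 ?_
      have hw : y ^ 3 / x ^ 2 ≠ 0 := fun hw => hx (by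
        rw [hw] at hs
        exact (pow_eq_zero_iff (by norm_num)).1 (hs.symm.trans (by norm_num)))
      refine (mul_eq_zero.1 (?_ : y ^ 3 / x ^ 2 * _ = 0)).resolve_left hw
      linear_combination x * h1 + 5 * invFormS p ((y ^ 3 / x ^ 2) ^ 2) (2 * (y ^ 3 / x ^ 2) ^ 5) 1
        * hs - invFormU p ((y ^ 3 / x ^ 2) ^ 2) (2 * (y ^ 3 / x ^ 2) ^ 5) 1 * hu
  · obtain ⟨h0, h1, h2, h3⟩ := h
    -- The combination x∂ₓ - y∂ᵧ kills u and sends s to 5(x⁵ - y⁵).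
    have hs : invFormS p (x * y) (x ^ 5 + y ^ 5) 1 = 0 := by
      refine (mul_eq_zero.1 (?_ : (x ^ 5 - y ^ 5) * _ = 0)).resolve_left (sub_ne_zero.2 hxy)
      linear_combination x * h1 / 5 - y * h2 / 5
    rw [hs] at h1 h2
    refine isExceptional_of_invForm h0 ?_ hs
    by_cases hx : x = 0
    · have hy : y ≠ 0 := fun hy => hxy (by rw [hx, hy])
      exact (mul_eq_zero.1 (by linear_combination h1)).resolve_right hy
    · exact (mul_eq_zero.1 (by linear_combination h2)).resolve_right hx

/-! ### Singular points of the exceptional members -/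

theorem IsExceptional.exists_isSingularAt {p : ℂ} (hp : IsExceptional p) :
    ∃ x y z, ¬(x = 0 ∧ y = 0 ∧ z = 0) ∧ IsSingularAt p x y z := by
  rcases hp with rfl | rfl | hp
  · refine ⟨0, 0, 1, by simp, ?_⟩
    constructor <;> norm_num [invForm, invFormU, invFormS, invFormZ, invSextic]
  · refine ⟨1, -1, 0, by simp, ?_⟩
    constructor <;> norm_num [invForm, invFormU, invFormS, invFormZ, invSextic]
  -- This makes p + c, b and a vanish at u, leaving only the quadratic -1500f² + b'f + a' = 0 for f;
  -- d is a square root of its discriminant.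
  · obtain ⟨u, rfl⟩ : ∃ u, p = 1500 * u - 2250 := ⟨(p + 2250) / 1500, by ring⟩
    have hq : 4 * u ^ 2 - 3 * u + 9 = 0 := by linear_combination hp / 562500
    have hu : u ≠ 0 := by
      rintro rfl
      norm_num at hq
    obtain ⟨d, hd⟩ := IsAlgClosed.exists_pow_nat_eq
      ((120000 * u ^ 3 - 1147500 * u ^ 2 - 5265000 * u + 1417500) ^ 2 + 6000 * (-1050000 * u ^ 6
        + 27675000 * u ^ 5 + 116437500 * u ^ 4 - 931500000 * u ^ 3 - 592312500 * u ^ 2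
        - 218700000 * u - 1011487500)) (n := 2) (by norm_num)
    obtain ⟨f, hf⟩ : ∃ f : ℂ, 3000 * f = (120000 * u ^ 3 - 1147500 * u ^ 2 - 5265000 * u
      + 1417500) + d := ⟨_, mul_div_cancel₀ _ (by norm_num)⟩
    obtain ⟨s, hs⟩ : ∃ s : ℂ, 9 * s = f - (10 * u ^ 3 - 45 * u ^ 2 - 135 * u + 27) :=
      ⟨_, mul_div_cancel₀ _ (by norm_num)⟩
    -- x⁵ and y⁵ are the roots of T² - sT + u⁵.
    obtain ⟨e, he⟩ := IsAlgClosed.exists_pow_nat_eq (s ^ 2 - 4 * u ^ 5) (n := 2) (by norm_num)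
    obtain ⟨x, hx⟩ := IsAlgClosed.exists_pow_nat_eq ((s + e) / 2) (n := 5) (by norm_num)
    have hx0 : x ≠ 0 := by
      rintro rfl
      have h1 : s + e = 0 := by linear_combination -2 * hx
      have : u ^ 5 = 0 := by linear_combination (s - e) * h1 / 4 + he / 4
      exact pow_ne_zero _ hu this
    obtain ⟨y, rfl⟩ : ∃ y, u = x * y := ⟨u / x, by field_simp⟩
    have hxs : x ^ 5 + y ^ 5 = s := by
      refine mul_left_cancel₀ (pow_ne_zero 5 hx0) ?_
      linear_combination (x ^ 5 + (s + e) / 2 - s) * hx + he / 4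
    generalize hxy : x * y = u at *
    obtain rfl : s = (f - (10 * u ^ 3 - 45 * u ^ 2 - 135 * u + 27)) / 9 := by
      linear_combination hs / 9
    have hff : -1500 * f ^ 2 + (120000 * u ^ 3 - 1147500 * u ^ 2 - 5265000 * u + 1417500) * f
        + (-1050000 * u ^ 6 + 27675000 * u ^ 5 + 116437500 * u ^ 4 - 931500000 * u ^ 3
        - 592312500 * u ^ 2 - 218700000 * u - 1011487500) = 0 := by
      linear_combination -hd / 6000 - (3000 * f - (120000 * u ^ 3 - 1147500 * u ^ 2 - 5265000 * u
        + 1417500) + d) * hf / 6000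
    generalize hS' : (f - (10 * u ^ 3 - 45 * u ^ 2 - 135 * u + 27)) / 9 = s at *
    have hF : invSextic u s 1 = f := by
      rw [invSextic, ← hS']; ring
    have hS : invFormS (1500 * u - 2250) u s 1 = 0 := by
      rw [invFormS, hF, ← hS']
      linear_combination 9 * (7500 * u ^ 2 - 90000 * u - 742500) * hq
    have hU : invFormU (1500 * u - 2250) u s 1 = 0 := by
      rw [invFormU, hF, ← hS']
      linear_combination hff
        + (30 * u ^ 2 - 90 * u - 135) * (7500 * u ^ 2 - 90000 * u - 742500) * hq
    have h0 : invForm (1500 * u - 2250) u s 1 = 0 := by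
      rw [invForm, hF, ← hS']
      linear_combination (7500 * u ^ 2 - 90000 * u - 742500) * f * hq + (-37500 * u ^ 5
        + 1125000 * u ^ 4 + 6750000 * u ^ 3 - 55687500 * u ^ 2 - 106312500 * u + 18225000) * hq
    have hZ : invFormZ (1500 * u - 2250) u s 1 = 0 := by
      -- Euler's identity with weights 2, 5, 1 for u, s, z.
      have : 12 * invForm (1500 * u - 2250) u s 1 = 2 * u * invFormU (1500 * u - 2250) u s 1
          + 5 * s * invFormS (1500 * u - 2250) u s 1 + invFormZ (1500 * u - 2250) u s 1 := by
        simp only [invForm, invFormU, invFormS, invFormZ, invSextic]; ring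
      linear_combination 12 * h0 - 2 * u * hU - 5 * s * hS - this
    refine ⟨x, y, 1, by simp, ?_⟩
    constructor <;> rw [hxy, hxs]
    · exact h0
    · rw [hU, hS]; ring
    · rw [hU, hS]; ring
    · exact hZ

/-! ### Nonreduced curves are singular on every line -/

theorem homogeneousComponent_totalDegree_mul {σ R : Type*} [CommRing R] [IsDomain R]
    {p q : MvPolynomial σ R} (hp : p ≠ 0) (hq : q ≠ 0) :
    homogeneousComponent (p * q).totalDegree (p * q) =
      homogeneousComponent p.totalDegree p * homogeneousComponent q.totalDegree q := by
  rw [totalDegree_mul_of_isDomain hp hq]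
  have hpq : p * q = (∑ i ∈ Finset.range (p.totalDegree + 1), homogeneousComponent i p) *
      ∑ j ∈ Finset.range (q.totalDegree + 1), homogeneousComponent j q := by
    rw [sum_homogeneousComponent, sum_homogeneousComponent]
  rw [hpq, Finset.sum_mul_sum]
  have h : ∀ i j, homogeneousComponent (p.totalDegree + q.totalDegree)
      (homogeneousComponent i p * homogeneousComponent j q) =
      if p.totalDegree + q.totalDegree = i + j then
        homogeneousComponent i p * homogeneousComponent j q else 0 := fun i j =>
    homogeneousComponent_of_mem
      ((homogeneousComponent_isHomogeneous i p).mul (homogeneousComponent_isHomogeneous j q))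
  simp only [map_sum, h]
  rw [Finset.sum_eq_single p.totalDegree, Finset.sum_eq_single q.totalDegree, if_pos rfl]
  · intro j _ hj
    exact if_neg fun h => hj (by omega)
  · intro h; exact absurd (Finset.self_mem_range_succ _) h
  · intro i hi hne
    refine Finset.sum_eq_zero fun j hj => if_neg ?_
    rw [Finset.mem_range] at hi hj
    omega
  · intro h; exact absurd (Finset.self_mem_range_succ _) h

/-- A homogeneous polynomial that is not squarefree is divisible by the square of a
form of positive degree. -/
theorem exists_isHomogeneous_sq_dvd {σ R : Type*} [Field R]
    {G : MvPolynomial σ R} {n : ℕ} (hG : G.IsHomogeneous n) (h0 : G ≠ 0) (hs : ¬ Squarefree G) :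
    ∃ (H : MvPolynomial σ R) (k : ℕ), k ≠ 0 ∧ H.IsHomogeneous k ∧ H * H ∣ G := by
  simp only [Squarefree, not_forall] at hs
  obtain ⟨h, ⟨q, rfl⟩, hu⟩ := hs
  have hh : h ≠ 0 := by rintro rfl; simp at h0
  have hq : q ≠ 0 := by rintro rfl; simp at h0
  -- From G = h²q, multiplicativity of leading forms gives the factorization into leading forms.
  refine ⟨homogeneousComponent h.totalDegree h, h.totalDegree, fun hd => hu ?_,
    homogeneousComponent_isHomogeneous _ _, homogeneousComponent q.totalDegree q, ?_⟩
  · rw [totalDegree_eq_zero_iff_eq_C] at hd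
    rw [hd]
    refine (IsUnit.mk0 _ fun hc => hh ?_).map C
    rw [hd, hc, C_0]
  · rw [← homogeneousComponent_totalDegree_mul hh hh,
      ← homogeneousComponent_totalDegree_mul (mul_ne_zero hh hh) hq, hG.totalDegree h0,
      homogeneousComponent_eq_self hG]

theorem eval_smul_of_isHomogeneous {σ R : Type*} [CommRing R] {H : MvPolynomial σ R} {k : ℕ}
    (hH : H.IsHomogeneous k) (c : R) (v : σ → R) : eval (c • v) H = c ^ k * eval v H := by
  rw [eval_eq, eval_eq, Finset.mul_sum]
  refine Finset.sum_congr rfl fun d hd => ?_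
  have hk : ∑ i ∈ d.support, d i = k := by
    have := hH (mem_support_iff.1 hd)
    rw [← this, ← Finsupp.degree_apply, Finsupp.degree_eq_weight_one]
    rfl
  simp only [Pi.smul_apply, smul_eq_mul, mul_pow, Finset.prod_mul_distrib,
    Finset.prod_pow_eq_pow_sum, hk]
  ring

/-- A form of positive degree vanishes somewhere on each projective line. -/
theorem exists_eval_eq_zero_on_line {σ : Type*} {H : MvPolynomial σ ℂ} {k : ℕ} (hk : k ≠ 0)
    (hH : H.IsHomogeneous k) (a b : σ → ℂ) :
    ∃ s t : ℂ, ¬(s = 0 ∧ t = 0) ∧ eval (s • a + t • b) H = 0 := by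
  by_contra! hne
  -- A polynomial in t without roots is constant. Applied in both directions, this gives H(a) = H(a
  -- + b) = H(b), and 2ᵏH(a) = 2ᵏH(a + b/2) = H(2a + b) = H(b), so 2ᵏ = 1.
  have hconst : ∀ a b : σ → ℂ, (∀ t : ℂ, eval (a + t • b) H ≠ 0) →
      ∀ t : ℂ, eval (a + t • b) H = eval a H := by
    intro a b hab t
    let P : Polynomial ℂ := aeval (fun i => Polynomial.C (a i) + Polynomial.X * Polynomial.C (b i)) H
    have hP : ∀ t, P.eval t = eval (a + t • b) H := by
      intro t
      rw [← Polynomial.coe_aeval_eq_eval, comp_aeval_apply, ← MvPolynomial.coe_aeval_eq_eval]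
      simp only [map_add, map_mul, Polynomial.aeval_X, Polynomial.aeval_C, Algebra.algebraMap_self,
        RingHom.id_apply]
      rfl
    have hd : P.degree = 0 := by
      by_contra hd
      obtain ⟨t, ht⟩ := IsAlgClosed.exists_root P hd
      exact hab t (by rw [← hP]; exact ht)
    rw [Polynomial.eq_C_of_degree_eq_zero hd] at hP
    have h0 := hP 0
    rw [Polynomial.eval_C, zero_smul, add_zero] at h0
    rw [← hP t, Polynomial.eval_C, h0]
  have h1 := hconst a b (fun t => by simpa using hne 1 t (by simp))
  have h2 := hconst b a (fun t => by simpa [add_comm] using hne t 1 (by simp))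
  have e1 : eval b H = eval a H := by
    rw [← h1 1, ← h2 1, one_smul, one_smul, add_comm]
  have e2 : (2 : ℂ) ^ k * eval a H = eval b H := by
    rw [← h1 (1 / 2), ← eval_smul_of_isHomogeneous hH, smul_add, smul_smul, ← h2 2, add_comm]
    norm_num
  have ha : eval a H ≠ 0 := by simpa using hne 1 0 (by simp)
  have h3 : (2 : ℂ) ^ k = 1 := mul_right_cancel₀ ha (by rw [e2, e1, one_mul])
  have h4 : (2 : ℕ) ^ k = 1 := by exact_mod_cast h3
  exact absurd h4 (Nat.one_lt_two_pow hk).ne'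

/-- A plane curve that is not reduced has a singular point on each line. -/
theorem exists_singular_on_line {G : MvPolynomial (Fin 3) ℂ} {n : ℕ} (hG : G.IsHomogeneous n)
    (h0 : G ≠ 0) (hs : ¬ Squarefree G) (a b : Fin 3 → ℂ) :
    ∃ s t : ℂ, ¬(s = 0 ∧ t = 0) ∧ eval (s • a + t • b) G = 0 ∧
      ∀ i, eval (s • a + t • b) (pderiv i G) = 0 := by
  obtain ⟨H, k, hk, hH, q, rfl⟩ := exists_isHomogeneous_sq_dvd hG h0 hs
  obtain ⟨s, t, hst, h⟩ := exists_eval_eq_zero_on_line hk hH a b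
  refine ⟨s, t, hst, by simp [h], fun i => by simp [Derivation.leibniz, h]⟩

theorem isReducedCurve_iff_squarefree {G : MvPolynomial (Fin 3) ℂ} (h0 : G ≠ 0) :
    IsReducedCurve G ↔ Squarefree G := by
  rw [IsReducedCurve, ← Ideal.isRadical_iff_quotient_reduced, ← isRadical_iff_span_singleton,
    isRadical_iff_squarefree_of_ne_zero h0]

/-! ### Reducedness in the pencil -/

theorem isHomogeneous_ofNat (n : ℕ) [n.AtLeastTwo] :
    (ofNat(n) : MvPolynomial (Fin 3) ℂ).IsHomogeneous 0 :=
  isHomogeneous_C _ (OfNat.ofNat n)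

theorem isHomogeneous_wimanSextic : wimanSextic.IsHomogeneous 6 := by
  have hX (i : Fin 3) (m : ℕ) : (X i ^ m : MvPolynomial (Fin 3) ℂ).IsHomogeneous m :=
    isHomogeneous_X_pow i m
  have hx (i : Fin 3) : (X i : MvPolynomial (Fin 3) ℂ).IsHomogeneous 1 := isHomogeneous_X ℂ i
  exact (((((((isHomogeneous_ofNat 10).mul (hX 0 3)).mul (hX 1 3)).add
    (((isHomogeneous_ofNat 9).mul (hX 0 5)).mul (hx 2))).add
    (((isHomogeneous_ofNat 9).mul (hX 1 5)).mul (hx 2))).sub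
    ((((isHomogeneous_ofNat 45).mul (hX 0 2)).mul (hX 1 2)).mul (hX 2 2))).sub
    ((((isHomogeneous_ofNat 135).mul (hx 0)).mul (hx 1)).mul (hX 2 4))).add
    ((isHomogeneous_ofNat 27).mul (hX 2 6))

theorem isHomogeneous_hessian {G : MvPolynomial (Fin 3) ℂ} {n : ℕ} (hG : G.IsHomogeneous n) :
    (hessian G).IsHomogeneous (3 * (n - 1 - 1)) := by
  have h (i j : Fin 3) : (pderiv i (pderiv j G)).IsHomogeneous (n - 1 - 1) := hG.pderiv.pderiv
  have h3 (i j k l r s : Fin 3) : (pderiv i (pderiv j G) * pderiv k (pderiv l G) *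
      pderiv r (pderiv s G)).IsHomogeneous (3 * (n - 1 - 1)) := by
    convert ((h i j).mul (h k l)).mul (h r s) using 1
    ring
  rw [hessian, Matrix.det_fin_three]
  simp only [Matrix.of_apply]
  exact (((((h3 _ _ _ _ _ _).sub (h3 _ _ _ _ _ _)).sub (h3 _ _ _ _ _ _)).add
    (h3 _ _ _ _ _ _)).add (h3 _ _ _ _ _ _)).sub (h3 _ _ _ _ _ _)

theorem isHomogeneous_pencilForm (a b : ℂ) : (pencilForm a b).IsHomogeneous 12 :=
  ((isHomogeneous_C _ a).mul (isHomogeneous_wimanSextic.pow 2)).add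
    ((isHomogeneous_C _ b).mul (isHomogeneous_hessian isHomogeneous_wimanSextic))

/-- The zero form would be singular at (1 : 0 : 0) and (0 : 1 : 0). -/
theorem pencilForm_one_right_ne_zero (p : ℂ) : pencilForm p 1 ≠ 0 := by
  intro h
  have hs (v : Fin 3 → ℂ) : IsSingularAt p (v 0) (v 1) (v 2) :=
    (isSingularAt_iff p v).2 (by simp [h])
  have hp := (hs ![1, 0, 0]).eq_of_z_eq_zero (by simp)
  subst hp
  exact not_isSingularAt_of_x_eq_zero (y := 1) (z := 0) (by simp) (hs ![0, 1, 0])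

theorem squarefree_pencilForm (p : ℂ) : Squarefree (pencilForm p 1) := by
  by_contra hs
  have h := exists_singular_on_line (isHomogeneous_pencilForm p 1)
    (pencilForm_one_right_ne_zero p) hs
  have hp : p = -10125 := by
    obtain ⟨s, t, hst, h⟩ := h ![1, 0, 0] ![0, 1, 0]
    have h := (isSingularAt_iff p _).2 h
    simp at h
    exact h.eq_of_z_eq_zero hst
  subst hp
  obtain ⟨s, t, hst, h⟩ := h ![0, 1, 0] ![0, 0, 1]
  have h := (isSingularAt_iff _ _).2 h
  simp at h
  exact not_isSingularAt_of_x_eq_zero hst h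

theorem wimanSextic_ne_zero : wimanSextic ≠ 0 := by
  intro h
  have : eval ![0, 0, 1] wimanSextic = 0 := by rw [h, map_zero]
  simp [wimanSextic_eq_invSextic, invSextic] at this

theorem eval_wimanSextic_eq_zero : eval ![1, 0, 0] wimanSextic = 0 := by
  simp [wimanSextic_eq_invSextic, invSextic]

theorem pencilForm_one_zero : pencilForm 1 0 = wimanSextic ^ 2 := by
  simp [pencilForm]

theorem not_isReducedCurve_pencilForm_one_zero : ¬ IsReducedCurve (pencilForm 1 0) := by
  rw [pencilForm_one_zero, isReducedCurve_iff_squarefree (pow_ne_zero _ wimanSextic_ne_zero)]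
  intro h
  -- Squarefreeness would make `F` a unit, yet it vanishes at (1 : 0 : 0).
  have h := (h wimanSextic (by rw [sq])).map (eval ![1, 0, 0])
  rw [eval_wimanSextic_eq_zero] at h
  exact not_isUnit_zero h

theorem isSingularCurve_pencilForm_one_zero : IsSingularCurve (pencilForm 1 0) := by
  refine ⟨![1, 0, 0], fun h => one_ne_zero (congrFun h 0), ?_, fun i => ?_⟩ <;>
    simp [pencilForm_one_zero, Derivation.leibniz_pow, eval_wimanSextic_eq_zero]

/-! ### Conclusion -/

theorem isExceptional_iff (p : ℂ) : IsExceptional p ↔ IsSingularCurve (pencilForm p 1) := by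
  rw [isSingularCurve_pencilForm_iff]
  exact ⟨fun h => h.exists_isSingularAt, fun ⟨_, _, _, hv, h⟩ => h.isExceptional hv⟩

/-- The discriminant is -15·1125². -/
theorem exists_conj_roots : ∃ ξ : ℂ, ξ ≠ conj ξ ∧
    {p : ℂ | p ^ 2 + 3375 * p + 7593750 = 0} = {ξ, conj ξ} := by
  have hr : ((√15 : ℝ) : ℂ) ^ 2 = 15 := by
    rw [← Complex.ofReal_pow, Real.sq_sqrt (by norm_num)]; norm_num
  obtain ⟨r, hr0⟩ : ∃ r : ℝ, r = √15 := ⟨_, rfl⟩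
  have hrp : 0 < r := by rw [hr0]; positivity
  rw [← hr0] at hr
  have hc : conj ((-3375 + 1125 * r * Complex.I) / 2) = (-3375 - 1125 * r * Complex.I) / 2 := by
    simp [map_ofNat, sub_eq_add_neg]
  refine ⟨(-3375 + 1125 * r * Complex.I) / 2, ?_, ?_⟩
  · rw [hc]
    intro h
    have : 1125 * (r : ℂ) * Complex.I = 0 := by linear_combination h
    simp [hrp.ne'] at this
  · ext p
    rw [hc, Set.mem_ofPred_eq, Set.mem_insert_iff, Set.mem_singleton_iff,
      ← sub_eq_zero (b := (-3375 + 1125 * (r : ℂ) * Complex.I) / 2),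
      ← sub_eq_zero (b := (-3375 - 1125 * (r : ℂ) * Complex.I) / 2), ← mul_eq_zero]
    have : p ^ 2 + 3375 * p + 7593750 = (p - (-3375 + 1125 * r * Complex.I) / 2) *
        (p - (-3375 - 1125 * r * Complex.I) / 2) := by
      linear_combination (1265625 / 4 * r ^ 2) * Complex.I_sq - 1265625 / 4 * hr
    rw [this]

theorem mainTheorem6 :
    (∃ ξ : ℂ, ξ ≠ conj ξ ∧
      {p : ℂ | p ^ 2 + 3375 * p + 7593750 = 0} = {ξ, conj ξ} ∧
      ∀ P : OnePoint ℂ, IsSingularCurve (curveForm P) ↔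
        (P = ∞ ∨ P = ((20250 : ℂ) : OnePoint ℂ) ∨ P = ((-10125 : ℂ) : OnePoint ℂ) ∨
          P = (ξ : OnePoint ℂ) ∨ P = ((conj ξ : ℂ) : OnePoint ℂ))) ∧
    (∀ P : OnePoint ℂ, IsReducedCurve (curveForm P) ↔ P ≠ ∞) := by
  obtain ⟨ξ, hne, hξ⟩ := exists_conj_roots
  refine ⟨⟨ξ, hne, hξ, fun P => ?_⟩, fun P => ?_⟩
  · induction P using OnePoint.rec with
    | infty => exact iff_of_true isSingularCurve_pencilForm_one_zero (Or.inl rfl)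
    | coe p =>
      have h : p ^ 2 + 3375 * p + 7593750 = 0 ↔ p = ξ ∨ p = conj ξ := Set.ext_iff.1 hξ p
      change IsSingularCurve (pencilForm p 1) ↔ _
      simp only [← isExceptional_iff, IsExceptional, h, OnePoint.coe_ne_infty, OnePoint.coe_eq_coe,
        false_or]
  · induction P using OnePoint.rec with
    | infty =>
      exact iff_of_false not_isReducedCurve_pencilForm_one_zero fun h => h rfl
    | coe p =>
      exact iff_of_true ((isReducedCurve_iff_squarefree (pencilForm_one_right_ne_zero p)).2
        (squarefree_pencilForm p)) (OnePoint.coe_ne_infty p)
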